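/- Let $X,Z,Y$ be Polish spaces (user features, item features, feedback) and let the sample space $\mathcal X\subseteq X\times Z\times Y$ be a Borel set of records $\mathbf h=(\mathbf x,\mathbf z,y)$ in which each feature pair $(\mathbf x,\mathbf z)$ carries exactly one feedback $y$ (for instance the finite set of records $(\mathbf x_u,\mathbf z_i,y_{u,i})$, $(u,i)\in\mathcal D$, with distinct feature pairs). Let $P$ be a Borel probability measure on $\mathcal X$ that gives positive mass to every nonempty open subset of $\mathcal X$. An exposure mechanism $Q$ is a conditional law of $O\in\{0,1\}$ given $(\mathbf x,\mathbf z)\in X\times Z$, depending measurably on $(\mathbf x,\mathbf z)$; write $q(O=1|\mathbf x,\mathbf z)$ for its propensity. If the propensities of $Q$ are bounded away from zero on $\mathcal X$, put $$\kappa_Q=\mathbb E_P\Big[\frac1{q(O=1|\mathbf X,\mathbf Z)}\Big],\qquad d(P/Q)=\frac{1}{\kappa_Q\,q(O=1|\mathbf x,\mathbf z)}\,dP ,$$ so that $P/Q$, also denoted $Q^{-1}$, is the propensity-weighted distribution after scaling to a probability measure on $\mathcal X$. For a cost $c:\mathcal X\times\mathcal X\to[0,\infty)$ and probability measures $P_1,P_2$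 on $\mathcal X$ let $$W_c(P_1,P_2)=\inf_{\gamma\in\Pi(P_1,P_2)}\mathbb E_{(\mathbf h,\mathbf h')\sim\gamma}[c(\mathbf h,\mathbf h')]\in[0,\infty],$$ where $\Pi(P_1,P_2)$ is the set of couplings of $P_1$ and $P_2$. Suppose that $c$ is continuous with $c(\mathbf t,\mathbf t)=0$ for all $\mathbf t$, and that the true exposure mechanism $Q_0$ satisfies $q_0(O=1|\mathbf x,\mathbf z)\ge\mu$ on $\mathcal X$ for some $\mu>0$. Let $P^*=P/Q_0$ be the exposure-free distribution. Let $f_\theta:X\times Z\to\mathbb R$ be a model and $\delta:Y\times\mathbb R\to\mathbb R$ a loss such that $(\mathbf x,\mathbf z,y)\mapsto\delta(y,f_\theta(\mathbf x,\mathbf z))$ is lower semicontinuous and bounded below on $\mathcal X$ (both are automatic if $\mathcal X$ is finite). Then for every $\rho>0$, with $\mathcal P=\{\hat P: W_c(\hat P,P^*)<\rho\}$ (all probability measures $\hat P$ on $\mathcal X$ in the open Wasserstein ball around $P^*$), $$\sup_{\hat P\in\mathcal P}\mathbb E_{\hat P}\big[\delta(Y,f_\theta(\mathbf X,\mathbf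 Z))\big]=\inf_{\alpha\ge0}\Big\{\alpha\rho+\sup_{\hat Q}\Big\{\mathbb E_P\Big[\frac{\delta(Y,f_\theta(\mathbf X,\mathbf Z))}{\kappa_{\hat Q}\,\hat q(O=1|\mathbf X,\mathbf Z)}\Big]-c_0\,\alpha\,W_c\big(\hat Q^{-1},Q_0^{-1}\big)\Big\}\Big\},$$ with the constant $c_0=1$, where $\hat Q$ ranges over all exposure mechanisms whose propensities are bounded away from zero on $\mathcal X$ (each by its own positive bound). Both sides are understood in $(-\infty,+\infty]$, and $0\cdot\infty=0$ in the product $\alpha W_c$. -/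

import Mathlib

open MeasureTheory ProbabilityTheory
open scoped ENNReal NNReal

namespace ExposureDual

noncomputable section

/-- The extended expectation `E_m[φ] = E_m[φ⁺] - E_m[φ⁻]`, with values in `[-∞, ∞]`. It is only used
for `φ` whose negative part has finite expectation. -/
def expect {H : Type*} [MeasurableSpace H] (m : Measure H) (φ : H → ℝ) : EReal :=
  ((∫⁻ h, ENNReal.ofReal (φ h) ∂m : ℝ≥0∞) : EReal)
    - ((∫⁻ h, ENNReal.ofReal (-φ h) ∂m : ℝ≥0∞) : EReal)

/-- The set `Π(m₁, m₂)` of couplings: measures on the product with marginals `m₁` and `m₂`. -/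
def couplings {H : Type*} [MeasurableSpace H] (m₁ m₂ : Measure H) : Set (Measure (H × H)) :=
  {γ | γ.map Prod.fst = m₁ ∧ γ.map Prod.snd = m₂}

/-- The Wasserstein (optimal transport) discrepancy
`W_c(m₁, m₂) = inf_{γ ∈ Π(m₁, m₂)} E_{(h, h') ∼ γ}[c(h, h')]`, with values in `[0, ∞]`. -/
def wasserstein {H : Type*} [MeasurableSpace H] (c : H → H → ℝ≥0) (m₁ m₂ : Measure H) : ℝ≥0∞ :=
  ⨅ γ ∈ couplings m₁ m₂, ∫⁻ p, (c p.1 p.2 : ℝ≥0∞) ∂γ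

section Exposure

variable {X Z Y : Type*} [MeasurableSpace X] [MeasurableSpace Z] [MeasurableSpace Y]
  {S : Set (X × Z × Y)}

/-- The propensity `q(O = 1 | x, z)` at a record `h = (x, z, y)` of the sample space `S`, for an
exposure mechanism `Q`, i.e. a conditional law `Q(O ∈ · | x, z)` of the exposure status
(`true` stands for `O = 1`). -/
def propensity (Q : Kernel (X × Z) Bool) (h : S) : ℝ :=
  (Q (h.1.1, h.1.2.1)).real {true}

/-- The propensities of `Q` are bounded away from zero on the sample space. -/
def BoundedAwayFromZero (S : Set (X × Z × Y)) (Q : Kernel (X × Z) Bool) : Prop :=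
  ∃ ε : ℝ, 0 < ε ∧ ∀ h : S, ε ≤ propensity Q h

/-- The inverse propensity weight, after scaling to mean one under `P`:
`(1 / q(O = 1 | x, z)) / E_P[1 / q(O = 1 | X, Z)]`. -/
def invWeight (P : Measure S) (Q : Kernel (X × Z) Bool) (h : S) : ℝ :=
  (1 / propensity Q h) / ∫ h', 1 / propensity Q h' ∂P

/-- The propensity-weighted distribution `P / Q` (also written `Q⁻¹`) on the sample space: the
probability distribution whose density with respect to `P` is proportional to
`1 / q(O = 1 | x, z)`. -/
def weighted (P : Measure S) (Q : Kernel (X × Z) Bool) : Measure S :=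
  P.withDensity fun h => ENNReal.ofReal (invWeight P Q h)

end Exposure

end

end ExposureDual

namespace ExposureDual

/-! Write `m₀ = P/Q₀`, and let φ be the loss. A mechanism with propensities bounded away from zero
weights `P` by a density lying between two positive constants. Conversely, such a density `w ≥ a`
comes from the propensity `a / w`, which is a function of the features because they determine the
record (`Comparable.exists_weighted_eq`). So the inner supremum runs over all measures comparable to
`P`.

For "≤", comparable measures must do as well as arbitrary ones in the open ball. Each first point of
a nearly optimal coupling with `m₀` is resampled from `P` conditioned on a small open set, of
positive mass since `P` has full support; mixing in a little `m₀` gives the lower bound on the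
density (`Comparable.exists_approx`). Continuity of the cost and lower semicontinuity of the loss
control the error.

For "≥", comparable measures form a convex set on which the expectation is affine and `W_c(·, m₀)`
is convex, and `m₀` is a Slater point, at distance 0 < ρ. A supporting line in the plane of (radius,
value) pairs gives the multiplier (`Comparable.exists_multiplier`). -/

/-- `m` is a probability measure that is bounded below and above by positive multiples of `P`. -/
structure Comparable {H : Type*} [MeasurableSpace H] (P m : Measure H) : Prop where
  prob : IsProbabilityMeasure m
  lower : ∃ a : ℝ≥0, 0 < a ∧ a • P ≤ m
  upper : ∃ K : ℝ≥0, m ≤ K • P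

lemma propensity_le_one {X Z Y : Type*} [MeasurableSpace X] [MeasurableSpace Z]
    {S : Set (X × Z × Y)} (Q : Kernel (X × Z) Bool) [IsMarkovKernel Q] (h : S) :
    propensity Q h ≤ 1 :=
  measureReal_le_one

/-! ### Propensity-weighted distributions and construction of mechanisms. -/

section Exposure

variable {X Z Y : Type*} [MeasurableSpace X] [MeasurableSpace Z] [MeasurableSpace Y]
  {S : Set (X × Z × Y)}

lemma measurable_features :
    Measurable (fun h : S => ((h : X × Z × Y).1, (h : X × Z × Y).2.1)) := by
  fun_prop

lemma measurable_propensity (Q : Kernel (X × Z) Bool) :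
    Measurable (propensity Q : S → ℝ) :=
  ((Q.measurable_coe (measurableSet_singleton true)).comp measurable_features).ennreal_toReal

lemma measurable_invWeight (P : Measure S) (Q : Kernel (X × Z) Bool) :
    Measurable (invWeight P Q) :=
  (measurable_const.div (measurable_propensity Q)).div_const _

lemma invWeight_nonneg (P : Measure S) (Q : Kernel (X × Z) Bool) (h : S) :
    0 ≤ invWeight P Q h := by
  have hp : ∀ h : S, 0 ≤ 1 / propensity Q h := fun h => by
    unfold propensity; positivity
  exact div_nonneg (hp h) (integral_nonneg hp)

/-- Since 1 ≤ 1/q ≤ 1/ε, the normalizing constant also lies in [1, 1/ε], so the normalized weight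
lies in [ε, 1/ε]. -/
lemma weighted_comparable (P : Measure S) [IsProbabilityMeasure P] (Q : Kernel (X × Z) Bool)
    [IsMarkovKernel Q] (hQ : BoundedAwayFromZero S Q) : Comparable P (weighted P Q) := by
  obtain ⟨ε, hε, hQ⟩ := hQ
  have hlow : ∀ h : S, 1 ≤ 1 / propensity Q h := fun h =>
    (one_le_div (hε.trans_le (hQ h))).2 (propensity_le_one Q h)
  have hup : ∀ h : S, 1 / propensity Q h ≤ 1 / ε := fun h => one_div_le_one_div_of_le hε (hQ h)
  have hint : Integrable (fun h : S => 1 / propensity Q h) P := by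
    refine Integrable.of_bound (measurable_const.div (measurable_propensity Q)).aestronglyMeasurable
      (1 / ε) (ae_of_all _ fun h => ?_)
    rw [Real.norm_of_nonneg (zero_le_one.trans (hlow h))]
    exact hup h
  have hκ1 : 1 ≤ ∫ h, 1 / propensity Q h ∂P := by
    simpa using integral_mono (integrable_const (1 : ℝ)) hint hlow
  have hκ2 : ∫ h, 1 / propensity Q h ∂P ≤ 1 / ε := by
    simpa using integral_mono hint (integrable_const (1 / ε : ℝ)) hup
  have hw1 : ∀ h : S, ε ≤ invWeight P Q h := fun h => by
    rw [invWeight, le_div_iff₀ (by linarith)]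
    calc ε * _ ≤ ε * (1 / ε) := by gcongr
      _ = 1 := by field_simp
      _ ≤ _ := hlow h
  have hw2 : ∀ h : S, invWeight P Q h ≤ 1 / ε := fun h =>
    (div_le_self (zero_le_one.trans (hlow h)) hκ1).trans (hup h)
  refine ⟨⟨?_⟩, ⟨ε.toNNReal, Real.toNNReal_pos.2 hε, ?_⟩, ⟨(1 / ε).toNNReal, ?_⟩⟩
  · rw [weighted, withDensity_apply _ MeasurableSet.univ, setLIntegral_univ,
      ← ofReal_integral_eq_lintegral_ofReal (show Integrable (invWeight P Q) P from hint.div_const _)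
        (ae_of_all _ (invWeight_nonneg P Q))]
    simp only [invWeight]
    rw [integral_div, div_self (by linarith), ENNReal.ofReal_one]
  · rw [show ε.toNNReal • P = P.withDensity fun _ => ENNReal.ofReal ε from
      (withDensity_const _).symm]
    exact withDensity_mono (ae_of_all _ fun h => ENNReal.ofReal_le_ofReal (hw1 h))
  · rw [show (1 / ε).toNNReal • P = P.withDensity fun _ => ENNReal.ofReal (1 / ε) from
      (withDensity_const _).symm]
    exact withDensity_mono (ae_of_all _ fun h => ENNReal.ofReal_le_ofReal (hw2 h))

/-- The conditional law of the exposure status with propensity function `q`. -/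
noncomputable def mechanism {F : Type*} [MeasurableSpace F] (q : F → ℝ) (hq : Measurable q) :
    Kernel F Bool where
  toFun x := ENNReal.ofReal (q x) • Measure.dirac true
    + ENNReal.ofReal (1 - q x) • Measure.dirac false
  measurable' := by
    refine Measure.measurable_of_measurable_coe _ fun s _ => ?_
    simp only [Measure.coe_add, Measure.coe_smul, Pi.add_apply, Pi.smul_apply, smul_eq_mul]
    exact (hq.ennreal_ofReal.mul_const _).add
      ((measurable_const.sub hq).ennreal_ofReal.mul_const _)

lemma isMarkovKernel_mechanism {F : Type*} [MeasurableSpace F] (q : F → ℝ) (hq : Measurable q)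
    (h0 : ∀ x, 0 ≤ q x) (h1 : ∀ x, q x ≤ 1) : IsMarkovKernel (mechanism q hq) := by
  refine ⟨fun x => ⟨?_⟩⟩
  change (ENNReal.ofReal (q x) • Measure.dirac true
    + ENNReal.ofReal (1 - q x) • Measure.dirac false : Measure Bool) Set.univ = 1
  simp [← ENNReal.ofReal_add (h0 x) (sub_nonneg.2 (h1 x))]

lemma mechanism_real_true {F : Type*} [MeasurableSpace F] (q : F → ℝ) (hq : Measurable q)
    (h0 : ∀ x, 0 ≤ q x) (x : F) : (mechanism q hq x).real {true} = q x := by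
  change ((ENNReal.ofReal (q x) • Measure.dirac true
    + ENNReal.ofReal (1 - q x) • Measure.dirac false : Measure Bool) {true}).toReal = q x
  simp [h0 x]

end Exposure

/-! ### From comparable measures back to mechanisms. -/

/-- A measure comparable to `P` has a density with values between two positive constants. -/
lemma Comparable.exists_density {H : Type*} [MeasurableSpace H] {P m : Measure H}
    [IsProbabilityMeasure P] (hm : Comparable P m) :
    ∃ (w : H → ℝ) (a K : ℝ), Measurable w ∧ 0 < a ∧ (∀ h, a ≤ w h) ∧ (∀ h, w h ≤ K) ∧
      m = P.withDensity fun h => ENNReal.ofReal (w h) := by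
  obtain ⟨hprob, ⟨a, ha, hl⟩, K, hu⟩ := hm
  have hac : m ≪ P := hu.absolutelyContinuous.trans Measure.smul_absolutelyContinuous
  have hmeas := Measure.measurable_rnDeriv m P
  have hd : P.withDensity (m.rnDeriv P) = m := Measure.withDensity_rnDeriv_eq m P hac
  have h1 : (fun _ => (a : ℝ≥0∞)) ≤ᵐ[P] m.rnDeriv P := by
    refine ae_le_of_forall_setLIntegral_le_of_sigmaFinite measurable_const fun s hs _ => ?_
    rw [← withDensity_apply _ hs, ← withDensity_apply _ hs, hd, withDensity_const]
    exact hl s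
  have h2 : m.rnDeriv P ≤ᵐ[P] fun _ => (K : ℝ≥0∞) := by
    refine ae_le_of_forall_setLIntegral_le_of_sigmaFinite hmeas fun s hs _ => ?_
    rw [← withDensity_apply _ hs, ← withDensity_apply _ hs, hd, withDensity_const]
    exact hu s
  -- Clipping the Radon–Nikodym derivative makes the bounds hold everywhere rather than almost
  -- everywhere.
  refine ⟨fun h => max a (min K (m.rnDeriv P h).toReal), a, max a K,
    by fun_prop, ha, fun h => le_max_left _ _,
    fun h => max_le_max le_rfl (min_le_left _ _), ?_⟩
  conv_lhs => rw [← hd]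
  refine withDensity_congr_ae ?_
  filter_upwards [h1, h2] with h h1 h2
  have hne : m.rnDeriv P h ≠ ∞ := ne_top_of_le_ne_top ENNReal.coe_ne_top h2
  have h3 : (a : ℝ) ≤ (m.rnDeriv P h).toReal := by
    simpa using ENNReal.toReal_mono hne h1
  have h4 : (m.rnDeriv P h).toReal ≤ K := by
    simpa using ENNReal.toReal_mono ENNReal.coe_ne_top h2
  rw [min_eq_right h4, max_eq_right h3, ENNReal.ofReal_toReal hne]

/-- If every feature pair carries one feedback, every measure comparable to `P` is a
propensity-weighted distribution. -/
theorem Comparable.exists_weighted_eq {X Z Y : Type*}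
    [TopologicalSpace X] [PolishSpace X] [MeasurableSpace X] [BorelSpace X]
    [TopologicalSpace Z] [PolishSpace Z] [MeasurableSpace Z] [BorelSpace Z]
    [TopologicalSpace Y] [PolishSpace Y] [MeasurableSpace Y] [BorelSpace Y]
    {S : Set (X × Z × Y)} (hS : MeasurableSet S)
    (hinj : Set.InjOn (fun h : X × Z × Y => (h.1, h.2.1)) S)
    {P m : Measure S} [IsProbabilityMeasure P] (hm : Comparable P m) :
    ∃ Q : Kernel (X × Z) Bool, IsMarkovKernel Q ∧ BoundedAwayFromZero S Q ∧
      weighted P Q = m := by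
  have := hm.prob
  obtain ⟨w, a, K, hw, ha, hl, hu, rfl⟩ := hm.exists_density
  have : StandardBorelSpace S := hS.standardBorel
  -- Lusin–Souslin: an injective measurable map on a standard Borel space is a measurable embedding,
  -- so `a / w` extends measurably to all feature pairs.
  have hemb : MeasurableEmbedding (fun h : S => ((h : X × Z × Y).1, (h : X × Z × Y).2.1)) :=
    measurable_features.measurableEmbedding fun h h' e => Subtype.ext (hinj h.2 h'.2 e)
  obtain ⟨g, hg, hge⟩ := hemb.exists_measurable_extend (measurable_const.div hw : Measurable
    fun h => a / w h) fun _ => ⟨0⟩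
  -- The extension is uncontrolled off the sample space, hence the clipping to [0, 1]; on the sample
  -- space 0 < a/w ≤ 1 and nothing changes.
  have hq : Measurable fun x => max 0 (min 1 (g x)) := by fun_prop
  have hq0 : ∀ x, 0 ≤ max 0 (min 1 (g x)) := fun x => le_max_left _ _
  have hq1 : ∀ x, max 0 (min 1 (g x)) ≤ 1 := fun x => max_le zero_le_one (min_le_left _ _)
  have hwpos : ∀ h, 0 < w h := fun h => ha.trans_le (hl h)
  have hprop : ∀ h : S, propensity (mechanism _ hq) h = a / w h := fun h => by
    rw [propensity, mechanism_real_true _ hq hq0]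
    have : g (h.1.1, h.1.2.1) = a / w h := congrFun hge h
    rw [this, min_eq_right ((div_le_one (hwpos h)).2 (hl h)),
      max_eq_right (div_pos ha (hwpos h)).le]
  have hint : ∫ h, w h ∂P = 1 := by
    have hi : Integrable w P := by
      refine Integrable.of_bound hw.aestronglyMeasurable K (ae_of_all _ fun h => ?_)
      rw [Real.norm_of_nonneg (hwpos h).le]
      exact hu h
    have h1 : (P.withDensity fun h => ENNReal.ofReal (w h)) Set.univ = 1 := measure_univ
    rw [withDensity_apply _ MeasurableSet.univ, setLIntegral_univ,
      ← ofReal_integral_eq_lintegral_ofReal hi (ae_of_all _ fun h => (hwpos h).le)] at h1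
    simpa using h1
  refine ⟨mechanism _ hq, isMarkovKernel_mechanism _ hq hq0 hq1, ⟨a / K, ?_, fun h => ?_⟩, ?_⟩
  · have : Nonempty S := nonempty_of_isProbabilityMeasure P
    obtain ⟨h⟩ := this
    exact div_pos ha ((hwpos h).trans_le (hu h))
  · rw [hprop]
    exact div_le_div_of_nonneg_left ha.le (hwpos h) (hu h)
  · rw [weighted]
    congr 1
    funext h
    congr 1
    -- The weight is (w/a) / ∫(w/a), and ∫ w = 1 makes `a` cancel.
    simp only [invWeight, hprop, one_div_div]
    rw [integral_div, hint]
    field_simp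

/-! ### Optimal transport: zero on the diagonal and convexity. -/

lemma wasserstein_self {H : Type*} [MeasurableSpace H] (c : H → H → ℝ≥0)
    (hc : Measurable (Function.uncurry c)) (hc0 : ∀ t, c t t = 0) (m : Measure H) :
    wasserstein c m m = 0 := by
  have hd : Measurable fun h : H => (h, h) := by fun_prop
  refine le_antisymm (iInf₂_le_of_le (m.map fun h => (h, h)) ⟨?_, ?_⟩ ?_) bot_le
  · rw [Measure.map_map measurable_fst hd]; exact Measure.map_id
  · rw [Measure.map_map measurable_snd hd]; exact Measure.map_id
  · rw [lintegral_map (f := fun p : H × H => (c p.1 p.2 : ℝ≥0∞)) hc.coe_nnreal_ennreal hd]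
    simp [hc0]

/-- The optimal transport discrepancy is convex in its first argument. -/
lemma wasserstein_mix_le {H : Type*} [MeasurableSpace H] (c : H → H → ℝ≥0)
    (m₁ m₂ m : Measure H) {s t : ℝ≥0} (hs : s ≠ 0) (ht : t ≠ 0)
    (hst : s + t = 1) :
    wasserstein c (s • m₁ + t • m₂) m ≤ s * wasserstein c m₁ m + t * wasserstein c m₂ m := by
  simp only [wasserstein]
  simp only [ENNReal.mul_iInf_of_ne (ENNReal.coe_ne_zero.2 hs) ENNReal.coe_ne_top,
    ENNReal.mul_iInf_of_ne (ENNReal.coe_ne_zero.2 ht) ENNReal.coe_ne_top, ENNReal.iInf_add,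
    ENNReal.add_iInf]
  refine le_iInf₂ fun γ₂ h₂ => le_iInf₂ fun γ₁ h₁ => ?_
  refine iInf₂_le_of_le (s • γ₁ + t • γ₂) ⟨?_, ?_⟩ ?_
  · rw [Measure.map_add _ _ measurable_fst, Measure.map_smul, Measure.map_smul, h₁.1, h₂.1]
  · rw [Measure.map_add _ _ measurable_snd, Measure.map_smul, Measure.map_smul, h₁.2, h₂.2]
    rw [← add_smul, hst, one_smul]
  · rw [lintegral_add_measure, lintegral_smul_measure, lintegral_smul_measure]
    rfl

/-! ### Approximation by measures comparable to `P`. -/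

/-- A countable family of nonempty open sets and a measurable choice among them such that, up to
`ε`, moving the first point of a pair inside the chosen set neither raises the cost nor lowers
`ψ`. -/
lemma exists_measurable_choice_open {H : Type*} [TopologicalSpace H] [SecondCountableTopology H]
    [MeasurableSpace H] [BorelSpace H] [Nonempty H]
    (c : H → H → ℝ≥0) (hc : Continuous (Function.uncurry c))
    (ψ : H → ℝ) (hψ : LowerSemicontinuous ψ) {ε : ℝ≥0} (hε : 0 < ε) :
    ∃ (B : ℕ → Set H) (k : H × H → ℕ), Measurable k ∧ (∀ n, IsOpen (B n)) ∧
      (∀ n, (B n).Nonempty) ∧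
      ∀ p, ∀ u ∈ B (k p), c u p.2 ≤ c p.1 p.2 + ε ∧ ψ p.1 ≤ ψ u + ε := by
  classical
  have hb := TopologicalSpace.isBasis_countableBasis H
  obtain ⟨B, hB⟩ := (TopologicalSpace.countable_countableBasis H).exists_eq_range (by
    obtain ⟨x⟩ := ‹Nonempty H›
    obtain ⟨v, hv, -⟩ := hb.exists_subset_of_mem_open (Set.mem_univ x) isOpen_univ
    exact ⟨v, hv⟩)
  have hmem : ∀ n, B n ∈ TopologicalSpace.countableBasis H := fun n => hB ▸ Set.mem_range_self n
  have hopen : ∀ n, IsOpen (B n) := fun n => hb.isOpen (hmem n)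
  let D : ℕ → Set (H × H) := fun n =>
    {p | p.1 ∈ B n} ∩ {p | ∀ u ∈ B n, c u p.2 ≤ c p.1 p.2 + ε ∧ ψ p.1 ≤ ψ u + ε}
  have hD : ∀ n, MeasurableSet (D n) := fun n => by
    -- The quantifier over uncountably many `u` is harmless: each condition is closed in `p`, the
    -- second because sublevel sets of `ψ` are closed.
    refine ((hopen n).measurableSet.preimage measurable_fst).inter (IsClosed.measurableSet ?_)
    simp only [Set.ofPred_forall]
    refine isClosed_iInter fun u => isClosed_iInter fun _ => IsClosed.inter ?_ ?_
    · exact isClosed_le (f := fun p : H × H => c u p.2) (g := fun p => c p.1 p.2 + ε)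
        (hc.comp (by fun_prop : Continuous fun p : H × H => (u, p.2))) (hc.add continuous_const)
    · exact (hψ.isClosed_preimage (ψ u + ε)).preimage continuous_fst
  have hex : ∀ p, ∃ n, p ∈ D n := fun p => by
    have h1 : ∀ᶠ u in nhds p.1, c u p.2 < c p.1 p.2 + ε :=
      ((hc.comp (by fun_prop : Continuous fun u : H => (u, p.2))).tendsto p.1).eventually_lt_const
        (lt_add_of_pos_right _ hε)
    have h2 : ∀ᶠ u in nhds p.1, ψ p.1 - ε < ψ u :=
      hψ p.1 _ (sub_lt_self _ (NNReal.coe_pos.2 hε))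
    obtain ⟨v, hv, hpv, hsub⟩ := hb.mem_nhds_iff.1 (h1.and h2)
    rw [hB] at hv
    obtain ⟨n, rfl⟩ := hv
    exact ⟨n, hpv, fun u hu => ⟨(hsub hu).1.le, by linarith [(hsub hu).2]⟩⟩
  exact ⟨B, fun p => Nat.find (hex p), measurable_find hex hD, hopen,
    fun n => TopologicalSpace.nonempty_of_mem_countableBasis (hmem n),
    fun p => (Nat.find_spec (hex p)).2⟩

/-- A coupling can be perturbed so that its first marginal is dominated by a multiple of `P` plus
the second marginal, with almost no increase in cost and almost no decrease in the expectation of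
`ψ`. -/
theorem exists_dominated_approx {H : Type*} [TopologicalSpace H] [SecondCountableTopology H]
    [MeasurableSpace H] [BorelSpace H] (P : Measure H) [IsProbabilityMeasure P]
    [P.IsOpenPosMeasure] (c : H → H → ℝ≥0) (hc : Continuous (Function.uncurry c))
    (hc0 : ∀ t, c t t = 0) (ψ : H → ℝ) (hψ : LowerSemicontinuous ψ)
    (γ : Measure (H × H)) [IsProbabilityMeasure γ] {ε : ℝ≥0} (hε : 0 < ε) {r : ℝ≥0∞}
    (hr : r < ∫⁻ p, ENNReal.ofReal (ψ p.1) ∂γ) :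
    ∃ (m : Measure H) (K : ℝ≥0), IsProbabilityMeasure m ∧ m ≤ K • P + γ.map Prod.snd ∧
      wasserstein c m (γ.map Prod.snd) ≤ ∫⁻ p, (c p.1 p.2 : ℝ≥0∞) ∂γ + ε ∧
      r ≤ ∫⁻ h, ENNReal.ofReal (ψ h) ∂m + ε := by
  classical
  have : Nonempty H := nonempty_of_isProbabilityMeasure P
  obtain ⟨B, k, hk, hBo, hBn, hB⟩ := exists_measurable_choice_open c hc ψ hψ hε
  have hψm : Measurable fun h => ENNReal.ofReal (ψ h) := hψ.measurable.ennreal_ofReal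
  have hcm : Measurable fun p : H × H => (c p.1 p.2 : ℝ≥0∞) := hc.measurable.coe_nnreal_ennreal
  have hP0 : ∀ n, P (B n) ≠ 0 := fun n => ((hBo n).measure_pos P (hBn n)).ne'
  have hset : ∀ N, MeasurableSet {p : H × H | k p < N} := fun N => measurableSet_lt hk measurable_const
  have hmono : Monotone fun N : ℕ => {p : H × H | k p < N} :=
    fun N M hNM p (hp : k p < N) => hp.trans_le hNM
  -- Only finitely many of the sets are used, so that the constant `K` below is finite; the cut-off
  -- is late enough to keep the integral above `r`.
  obtain ⟨N, hN⟩ : ∃ N : ℕ, r < ∫⁻ p in {p : H × H | k p < N}, ENNReal.ofReal (ψ p.1) ∂γ := by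
    have hU : ⋃ N : ℕ, {p : H × H | k p < N} = Set.univ :=
      Set.eq_univ_of_forall fun p => Set.mem_iUnion.2 ⟨k p + 1, Nat.lt_succ_self _⟩
    rw [← setLIntegral_univ, ← hU, setLIntegral_iUnion_of_directed _ hmono.directed_le] at hr
    exact lt_iSup_iff.1 hr
  have hcond : ∀ n, IsProbabilityMeasure P[|B n] := fun n => cond_isProbabilityMeasure (hP0 n)
  -- The first point of the pair is resampled from `P` conditioned on the chosen set. Past the
  -- cut-off it is replaced by the second point, which costs nothing and contributes at most the
  -- second marginal.
  let κ : Kernel (H × H) H := Kernel.piecewise (hset N)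
    ((Kernel.ofFunOfCountable fun n => P[|B n]).comap k hk)
    (Kernel.deterministic Prod.snd measurable_snd)
  have hκ1 : ∀ p, k p < N → κ p = P[|B (k p)] := fun p hp => by
    rw [Kernel.piecewise_apply, if_pos (show p ∈ _ from hp)]; rfl
  have hκ2 : ∀ p, ¬ k p < N → κ p = Measure.dirac p.2 := fun p hp => by
    rw [Kernel.piecewise_apply, if_neg (show p ∉ _ from hp)]; rfl
  have hκ : IsMarkovKernel κ := ⟨fun p => by
    by_cases hp : k p < N
    · rw [hκ1 p hp]; exact hcond _
    · rw [hκ2 p hp]; infer_instance⟩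
  have hmem : ∀ p, k p < N → ∀ᵐ u ∂κ p, u ∈ B (k p) := fun p hp => by
    rw [hκ1 p hp]; exact ae_cond_mem (hBo _).measurableSet
  have hsw : Measurable fun z : (H × H) × H => (z.2, z.1.2) := by fun_prop
  let K : ℝ≥0 := ∑ n ∈ Finset.range N, (P (B n)).toNNReal⁻¹
  refine ⟨(γ ⊗ₘ κ).map Prod.snd, K, ?_, ?_, ?_, ?_⟩
  · exact Measure.isProbabilityMeasure_map measurable_snd.aemeasurable
  · refine Measure.le_iff.2 fun s hs => ?_
    rw [Measure.map_apply measurable_snd hs, Measure.compProd_apply (measurable_snd hs)]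
    calc ∫⁻ p, κ p (Prod.mk p ⁻¹' (Prod.snd ⁻¹' s)) ∂γ
        ≤ ∫⁻ p, (K * P s + s.indicator 1 p.2) ∂γ := by
          refine lintegral_mono fun p => ?_
          change κ p s ≤ _
          by_cases hp : k p < N
          · refine le_add_right ?_
            rw [hκ1 p hp, cond_apply (hBo _).measurableSet]
            gcongr
            · have h1 : (P (B (k p))).toNNReal⁻¹ ≤ K :=
                Finset.single_le_sum (f := fun n => (P (B n)).toNNReal⁻¹) (fun _ _ => bot_le)
                  (Finset.mem_range.2 hp)
              refine le_trans (le_of_eq ?_) (ENNReal.coe_le_coe.2 h1)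
              rw [ENNReal.coe_inv, ENNReal.coe_toNNReal (measure_ne_top _ _)]
              exact (ENNReal.toNNReal_pos (hP0 _) (measure_ne_top _ _)).ne'
            · exact Set.inter_subset_right
          · refine le_add_left ?_
            rw [hκ2 p hp, Measure.dirac_apply' _ hs]
      _ = (K • P + γ.map Prod.snd) s := by
          rw [lintegral_add_left measurable_const, lintegral_const, measure_univ, mul_one,
            ← lintegral_map (measurable_one.indicator hs) measurable_snd,
            lintegral_indicator_one hs]
          rfl
  · refine iInf₂_le_of_le ((γ ⊗ₘ κ).map fun z => (z.2, z.1.2)) ⟨?_, ?_⟩ ?_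
    · rw [Measure.map_map measurable_fst hsw]; rfl
    · rw [Measure.map_map measurable_snd hsw]
      conv_rhs => rw [← Measure.fst_compProd γ κ]
      rw [Measure.fst, Measure.map_map measurable_snd measurable_fst]
      rfl
    · rw [lintegral_map hcm hsw, Measure.lintegral_compProd
        (f := fun z : (H × H) × H => (c z.2 z.1.2 : ℝ≥0∞)) (hcm.comp hsw)]
      calc ∫⁻ p, ∫⁻ u, (c u p.2 : ℝ≥0∞) ∂κ p ∂γ ≤ ∫⁻ p, ((c p.1 p.2 : ℝ≥0∞) + ε) ∂γ := by
            refine lintegral_mono fun p => ?_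
            by_cases hp : k p < N
            · calc ∫⁻ u, (c u p.2 : ℝ≥0∞) ∂κ p ≤ ∫⁻ _, ((c p.1 p.2 : ℝ≥0∞) + ε) ∂κ p := by
                    refine lintegral_mono_ae ?_
                    filter_upwards [hmem p hp] with u hu
                    exact_mod_cast (hB p u hu).1
                _ = _ := by simp
            · have : ∫⁻ u, (c u p.2 : ℝ≥0∞) ∂κ p = 0 := by
                rw [hκ2 p hp, lintegral_dirac' (f := fun u => (c u p.2 : ℝ≥0∞)) _
                  (hcm.comp (by fun_prop : Measurable fun u : H => (u, p.2)))]
                simp [hc0]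
              rw [this]; exact bot_le
        _ = _ := by rw [lintegral_add_right _ measurable_const]; simp
  · rw [lintegral_map hψm measurable_snd,
      Measure.lintegral_compProd
        (f := fun z : (H × H) × H => ENNReal.ofReal (ψ z.2)) (hψm.comp measurable_snd)]
    refine hN.le.trans ?_
    calc ∫⁻ p in {p : H × H | k p < N}, ENNReal.ofReal (ψ p.1) ∂γ
        ≤ ∫⁻ p in {p : H × H | k p < N}, (∫⁻ u, ENNReal.ofReal (ψ u) ∂κ p + ε) ∂γ := by
          refine setLIntegral_mono' (hset N) fun p hp => ?_
          calc ENNReal.ofReal (ψ p.1) = ∫⁻ _, ENNReal.ofReal (ψ p.1) ∂κ p := by simp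
            _ ≤ ∫⁻ u, (ENNReal.ofReal (ψ u) + ε) ∂κ p := by
                refine lintegral_mono_ae ?_
                filter_upwards [hmem p hp] with u hu
                refine (ENNReal.ofReal_le_ofReal (hB p u hu).2).trans ?_
                refine ENNReal.ofReal_add_le.trans ?_
                simp
            _ = _ := by rw [lintegral_add_right _ measurable_const]; simp
      _ ≤ ∫⁻ p, (∫⁻ u, ENNReal.ofReal (ψ u) ∂κ p + ε) ∂γ := setLIntegral_le_lintegral _ _
      _ = _ := by rw [lintegral_add_right _ measurable_const]; simp

lemma smul_measure_mono {H : Type*} [MeasurableSpace H] {m₁ m₂ : Measure H} (s : ℝ≥0)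
    (h : m₁ ≤ m₂) : s • m₁ ≤ s • m₂ :=
  Measure.le_intro fun A _ _ => mul_le_mul_right (h A) (s : ℝ≥0∞)

/-- Only `m₂` need be bounded below: its positive share `t` supplies the lower bound for the
mixture. -/
lemma Comparable.mix {H : Type*} [MeasurableSpace H] {P m₁ m₂ : Measure H}
    [IsProbabilityMeasure m₁] {K : ℝ≥0} (h₁ : m₁ ≤ K • P) (h₂ : Comparable P m₂) {s t : ℝ≥0}
    (ht : t ≠ 0) (hst : s + t = 1) : Comparable P (s • m₁ + t • m₂) := by
  obtain ⟨hp, ⟨a, ha, hl⟩, K', hu⟩ := h₂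
  refine ⟨⟨?_⟩, ⟨t * a, mul_pos (pos_iff_ne_zero.2 ht) ha, ?_⟩, s * K + t * K', ?_⟩
  · simp only [Measure.coe_add, Measure.coe_nnreal_smul_apply, Pi.add_apply, measure_univ, mul_one]
    exact_mod_cast hst
  · rw [mul_smul]
    exact (smul_measure_mono _ hl).trans (Measure.le_add_left le_rfl)
  · rw [add_smul, mul_smul, mul_smul]
    exact add_le_add (smul_measure_mono _ h₁)
      (smul_measure_mono _ hu)

/-- Finiteness passes from `m₁` to `P` by the lower bound and on to `m₂` by the upper one, so it
need only be checked at `m₀`. -/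
lemma Comparable.lintegral_lt_top {H : Type*} [MeasurableSpace H] {P m₁ m₂ : Measure H}
    (h₁ : Comparable P m₁) (h₂ : Comparable P m₂) {g : H → ℝ≥0∞} (hg : ∫⁻ h, g h ∂m₁ < ∞) :
    ∫⁻ h, g h ∂m₂ < ∞ := by
  obtain ⟨-, ⟨a, ha, hl⟩, -⟩ := h₁
  obtain ⟨-, -, K, hu⟩ := h₂
  have h1 : (a : ℝ≥0∞) * ∫⁻ h, g h ∂P ≤ ∫⁻ h, g h ∂m₁ := by
    have := lintegral_mono' hl (le_refl g)
    rwa [lintegral_smul_measure] at this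
  have h2 : ∫⁻ h, g h ∂m₂ ≤ K * ∫⁻ h, g h ∂P := by
    have := lintegral_mono' hu (le_refl g)
    rwa [lintegral_smul_measure] at this
  have h3 : ∫⁻ h, g h ∂P < ∞ := by
    refine lt_top_iff_ne_top.2 fun h => ?_
    rw [h, ENNReal.mul_top (ENNReal.coe_ne_zero.2 ha.ne')] at h1
    exact (h1.trans_lt hg).ne rfl
  exact h2.trans_lt (ENNReal.mul_lt_top ENNReal.coe_lt_top h3)

/-- Measures comparable to `P` are enough to approach, within an open Wasserstein ball around one
of them, the expectation of a lower semicontinuous function under any probability measure. -/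
theorem Comparable.exists_approx {H : Type*} [TopologicalSpace H] [SecondCountableTopology H]
    [MeasurableSpace H] [BorelSpace H] {P : Measure H} [IsProbabilityMeasure P]
    [P.IsOpenPosMeasure] {c : H → H → ℝ≥0} (hc : Continuous (Function.uncurry c))
    (hc0 : ∀ t, c t t = 0) {ψ : H → ℝ} (hψ : LowerSemicontinuous ψ)
    {m₀ m : Measure H} (hm₀ : Comparable P m₀) [IsProbabilityMeasure m] {ρ r : ℝ≥0∞}
    (hW : wasserstein c m m₀ < ρ) (hr : r = 0 ∨ r < ∫⁻ h, ENNReal.ofReal (ψ h) ∂m) :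
    ∃ m', Comparable P m' ∧ wasserstein c m' m₀ ≤ ρ ∧ r ≤ ∫⁻ h, ENNReal.ofReal (ψ h) ∂m' := by
  have hself : wasserstein c m₀ m₀ = 0 := wasserstein_self c hc.measurable hc0 m₀
  obtain rfl | hr := hr
  · exact ⟨m₀, hm₀, by rw [hself]; exact bot_le, bot_le⟩
  lift r to ℝ≥0 using hr.ne_top
  obtain ⟨γ, hγ, hcost⟩ : ∃ γ ∈ couplings m m₀, ∫⁻ p, (c p.1 p.2 : ℝ≥0∞) ∂γ < ρ := by
    simpa [wasserstein, iInf_lt_iff] using hW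
  have hγp : IsProbabilityMeasure γ := by
    refine ⟨?_⟩
    rw [← Set.preimage_univ (f := Prod.fst), ← Measure.map_apply measurable_fst MeasurableSet.univ,
      hγ.1, measure_univ]
  -- The slack `ε₁` pays for the extra cost and `ε₂` for the lost expectation: half of it in the
  -- perturbation, the rest in the mixing with `m₀`.
  obtain ⟨ε₁, hε₁, h₁⟩ := ENNReal.lt_iff_exists_add_pos_lt.1 hcost
  obtain ⟨ε₂, hε₂, h₂⟩ := ENNReal.lt_iff_exists_add_pos_lt.1 hr
  rw [← hγ.1, lintegral_map hψ.measurable.ennreal_ofReal measurable_fst] at h₂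
  obtain ⟨ν, K, hν, hνle, hνW, hνψ⟩ := exists_dominated_approx P c hc hc0 ψ hψ γ
    (lt_min hε₁ (half_pos hε₂)) h₂
  rw [hγ.2] at hνle hνW
  have hνψ' : ((r + ε₂ / 2 : ℝ≥0) : ℝ≥0∞) ≤ ∫⁻ h, ENNReal.ofReal (ψ h) ∂ν := by
    have h3 : ((r + ε₂ / 2 : ℝ≥0) : ℝ≥0∞) + (ε₂ / 2 : ℝ≥0)
        ≤ ∫⁻ h, ENNReal.ofReal (ψ h) ∂ν + (ε₂ / 2 : ℝ≥0) := by
      refine le_trans (le_of_eq ?_) (hνψ.trans ?_)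
      · rw [← ENNReal.coe_add, ← ENNReal.coe_add, add_assoc, add_halves]
      · gcongr
        exact min_le_right _ _
    exact (ENNReal.add_le_add_iff_right ENNReal.coe_ne_top).1 h3
  obtain ⟨K', hK'⟩ := hm₀.upper
  have hνK : ν ≤ (K + K') • P := hνle.trans (by rw [add_smul]; gcongr)
  have hd : 0 < r + ε₂ / 2 := by positivity
  -- The weight satisfies s(r + ε₂/2) = r + ε₂/4 ≥ r while leaving a positive share `t` for `m₀`.
  set s : ℝ≥0 := (r + ε₂ / 4) / (r + ε₂ / 2) with hs
  set t : ℝ≥0 := (ε₂ / 4) / (r + ε₂ / 2) with ht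
  have hs0 : s ≠ 0 := by positivity
  have ht0 : t ≠ 0 := by positivity
  have hst : s + t = 1 := by
    rw [hs, ht, ← add_div, div_eq_one_iff_eq hd.ne', add_assoc]
    congr 1
    apply NNReal.eq
    push_cast
    ring
  have hs1 : s ≤ 1 := hst ▸ le_self_add
  refine ⟨s • ν + t • m₀, hm₀.mix hνK ht0 hst, ?_, ?_⟩
  · refine (wasserstein_mix_le c ν m₀ m₀ hs0 ht0 hst).trans ?_
    rw [hself, mul_zero, add_zero]
    calc (s : ℝ≥0∞) * wasserstein c ν m₀ ≤ 1 * wasserstein c ν m₀ := by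
          gcongr; exact_mod_cast hs1
      _ ≤ _ := by
          rw [one_mul]
          refine hνW.trans (le_trans ?_ h₁.le)
          gcongr
          exact min_le_left _ _
  · rw [lintegral_add_measure, lintegral_smul_measure, lintegral_smul_measure]
    refine le_add_right ?_
    calc (r : ℝ≥0∞) ≤ ((s * (r + ε₂ / 2) : ℝ≥0) : ℝ≥0∞) := by
          rw [hs, div_mul_cancel₀ _ hd.ne']
          exact_mod_cast le_self_add
      _ ≤ _ := by
          rw [ENNReal.coe_mul]
          exact mul_le_mul_right hνψ' _

/-! ### Lagrange multipliers. -/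

/-- A nonnegative Lagrange multiplier for a planar convex set. -/
lemma exists_multiplier {A : Set (ℝ × ℝ)} (hA : Convex ℝ A) {e ρ v : ℝ} (he : (0, e) ∈ A)
    (hρ : 0 < ρ) (hv : ∀ p ∈ A, p.1 < ρ → p.2 ≤ v) :
    ∃ α : ℝ, 0 ≤ α ∧ ∀ p ∈ A, p.2 + α * (ρ - p.1) ≤ v := by
  -- Slopes of the lines joining points of `A` left of the vertical line at `ρ` to (ρ, v). Their
  -- infimum is the multiplier.
  let T : Set ℝ := (fun p : ℝ × ℝ => (v - p.2) / (ρ - p.1)) '' {p ∈ A | p.1 < ρ}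
  have hTne : T.Nonempty := ⟨_, (0, e), ⟨he, hρ⟩, rfl⟩
  have hT0 : ∀ x ∈ T, 0 ≤ x := by
    rintro x ⟨p, ⟨hp, hpρ⟩, rfl⟩
    exact div_nonneg (sub_nonneg.2 (hv p hp hpρ)) (sub_nonneg.2 hpρ.le)
  -- Slopes on the right do not exceed slopes on the left, in cross-multiplied form: the chord from
  -- `q` to `p` meets the vertical line at height at most `v`. The bound is known only strictly left
  -- of `ρ`, hence the one-sided limit.
  have key : ∀ p ∈ A, ρ ≤ p.1 → ∀ q ∈ A, q.1 < ρ →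
      (p.2 - v) * (ρ - q.1) ≤ (v - q.2) * (p.1 - ρ) := by
    intro p hp hpρ q hq hqρ
    have hpq : 0 < p.1 - q.1 := by linarith
    have hlim : (1 - (ρ - q.1) / (p.1 - q.1)) * q.2 + (ρ - q.1) / (p.1 - q.1) * p.2 ≤ v := by
      have hcont : Continuous fun t : ℝ => (1 - t) * q.2 + t * p.2 := by fun_prop
      refine le_of_tendsto ((hcont.tendsto ((ρ - q.1) / (p.1 - q.1))).mono_left
        (nhdsWithin_le_nhds (s := Set.Iio ((ρ - q.1) / (p.1 - q.1))))) ?_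
      filter_upwards [Ioo_mem_nhdsLT (div_pos (sub_pos.2 hqρ) hpq)] with t ht
      have ht1 : t ≤ 1 := ht.2.le.trans ((div_le_one hpq).2 (by linarith))
      have h1 := (lt_div_iff₀ hpq).1 ht.2
      refine hv _ (hA hq hp (sub_nonneg.2 ht1) ht.1.le (by ring)) ?_
      simp only [Prod.fst_add, Prod.smul_fst, smul_eq_mul]
      linarith
    have hmul := mul_le_mul_of_nonneg_right hlim hpq.le
    have hexp : ((1 - (ρ - q.1) / (p.1 - q.1)) * q.2 + (ρ - q.1) / (p.1 - q.1) * p.2)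
        * (p.1 - q.1) = (p.1 - ρ) * q.2 + (ρ - q.1) * p.2 := by
      field_simp
      ring
    rw [hexp] at hmul
    linarith
  refine ⟨sInf T, le_csInf hTne hT0, fun p hp => ?_⟩
  rcases lt_or_ge p.1 ρ with hlt | hge
  · have h1 : sInf T ≤ (v - p.2) / (ρ - p.1) := csInf_le ⟨0, hT0⟩ ⟨p, ⟨hp, hlt⟩, rfl⟩
    have := (le_div_iff₀ (sub_pos.2 hlt)).1 h1
    linarith
  · rcases hge.eq_or_lt with heq | hgt
    · have h1 := key p hp hge (0, e) he hρ
      rw [← heq, sub_self, mul_zero] at h1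
      have := nonpos_of_mul_nonpos_left h1 (sub_pos.2 hρ)
      rw [← heq, sub_self, mul_zero]
      linarith
    · have h1 : (p.2 - v) / (p.1 - ρ) ≤ sInf T := by
        refine le_csInf hTne ?_
        rintro x ⟨q, ⟨hq, hqρ⟩, rfl⟩
        exact (div_le_div_iff₀ (sub_pos.2 hgt) (sub_pos.2 hqρ)).2 (key p hp hge q hq hqρ)
      have := (div_le_iff₀ (sub_pos.2 hgt)).1 h1
      linarith

/-- Lagrange multiplier for maximizing `∫ ψ` over the measures comparable to `P` in a Wasserstein
ball. -/
theorem Comparable.exists_multiplier {H : Type*} [MeasurableSpace H] {P m₀ : Measure H}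
    {c : H → H → ℝ≥0} (hc : Measurable (Function.uncurry c)) (hc0 : ∀ t, c t t = 0)
    (hm₀ : Comparable P m₀) {g : H → ℝ≥0∞} (hg : ∫⁻ h, g h ∂m₀ < ∞) {ρ v : ℝ} (hρ : 0 < ρ)
    (hv : ∀ m, Comparable P m → wasserstein c m m₀ < ENNReal.ofReal ρ →
      (∫⁻ h, g h ∂m).toReal ≤ v) :
    ∃ α : ℝ, 0 ≤ α ∧ ∀ m, Comparable P m → wasserstein c m m₀ ≠ ∞ →
      (∫⁻ h, g h ∂m).toReal + α * (ρ - (wasserstein c m m₀).toReal) ≤ v := by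
  have hfin : ∀ {m}, Comparable P m → ∫⁻ h, g h ∂m ≠ ∞ :=
    fun hm => (hm₀.lintegral_lt_top hm hg).ne
  -- The inequality `≤` for the radius makes `A` convex, since the discrepancy is only convex in
  -- `m`. The sign condition is needed because `ENNReal.ofReal` sends negative radii to 0.
  let A : Set (ℝ × ℝ) := {p | 0 ≤ p.1 ∧ ∃ m, Comparable P m ∧
    wasserstein c m m₀ ≤ ENNReal.ofReal p.1 ∧ (∫⁻ h, g h ∂m).toReal = p.2}
  have hA : Convex ℝ A := by
    refine convex_iff_forall_pos.2 ?_
    rintro x ⟨hx0, m₁, hm₁, hW₁, hx⟩ y ⟨hy0, m₂, hm₂, hW₂, hy⟩ s t hs ht hst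
    lift s to ℝ≥0 using hs.le
    lift t to ℝ≥0 using ht.le
    have hst' : s + t = 1 := by exact_mod_cast hst
    have hs' : s ≠ 0 := by exact_mod_cast hs.ne'
    have ht' : t ≠ 0 := by exact_mod_cast ht.ne'
    have := hm₁.prob
    obtain ⟨K, hK⟩ := hm₁.upper
    refine ⟨by simp only [Prod.fst_add, Prod.smul_fst, smul_eq_mul]; positivity,
      s • m₁ + t • m₂, hm₂.mix hK ht' hst', ?_, ?_⟩
    · refine (wasserstein_mix_le c m₁ m₂ m₀ hs' ht' hst').trans ?_
      simp only [Prod.fst_add, Prod.smul_fst, smul_eq_mul]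
      rw [ENNReal.ofReal_add (by positivity) (by positivity), ENNReal.ofReal_mul (by positivity),
        ENNReal.ofReal_mul (by positivity), ENNReal.ofReal_coe_nnreal, ENNReal.ofReal_coe_nnreal]
      gcongr
    · rw [lintegral_add_measure, lintegral_smul_measure, lintegral_smul_measure,
        ENNReal.smul_def, ENNReal.smul_def, smul_eq_mul, smul_eq_mul,
        ENNReal.toReal_add (ENNReal.mul_ne_top ENNReal.coe_ne_top (hfin hm₁))
          (ENNReal.mul_ne_top ENNReal.coe_ne_top (hfin hm₂))]
      simp [hx, hy]
  obtain ⟨α, hα, h⟩ := ExposureDual.exists_multiplier hA (e := (∫⁻ h, g h ∂m₀).toReal) (v := v)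
    ⟨le_rfl, m₀, hm₀, by rw [wasserstein_self c hc hc0]; exact bot_le, rfl⟩ hρ (by
      rintro p ⟨hp0, m, hm, hW, hp⟩ hpρ
      rw [← hp]
      exact hv m hm (hW.trans_lt ((ENNReal.ofReal_lt_ofReal_iff hρ).2 hpρ)))
  exact ⟨α, hα, fun m hm hW => h (_, _)
    ⟨ENNReal.toReal_nonneg, m, hm, (ENNReal.ofReal_toReal hW).ge, rfl⟩⟩

/-! ### Extended expectations. -/

/-- The extended expectation of a function bounded below by `-β`. -/
lemma expect_eq_lintegral_sub {H : Type*} [MeasurableSpace H] (m : Measure H)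
    [IsProbabilityMeasure m] {φ : H → ℝ} (hφ : Measurable φ) {β : ℝ≥0} (hβ : ∀ h, -β ≤ φ h) :
    expect m φ = ((∫⁻ h, ENNReal.ofReal (φ h + β) ∂m : ℝ≥0∞) : EReal) - ((β : ℝ) : EReal) := by
  -- This is (φ + β) + φ⁻ = φ⁺ + β integrated, arranged to avoid truncated subtraction.
  have hadd : ∫⁻ h, ENNReal.ofReal (φ h + β) ∂m + ∫⁻ h, ENNReal.ofReal (-φ h) ∂m
      = ∫⁻ h, ENNReal.ofReal (φ h) ∂m + β := by
    have h1 : (β : ℝ≥0∞) = ∫⁻ _, (β : ℝ≥0∞) ∂m := by simp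
    rw [h1, ← lintegral_add_left (hφ.add_const _).ennreal_ofReal,
      ← lintegral_add_left hφ.ennreal_ofReal]
    refine lintegral_congr fun h => ?_
    have hb := hβ h
    rcases le_total 0 (φ h) with h0 | h0
    · rw [ENNReal.ofReal_of_nonpos (neg_nonpos.2 h0), add_zero, ENNReal.ofReal_add h0 β.coe_nonneg,
        ENNReal.ofReal_coe_nnreal]
    · rw [ENNReal.ofReal_of_nonpos h0, zero_add, ← ENNReal.ofReal_add (by linarith) (by linarith),
        ← ENNReal.ofReal_coe_nnreal]
      congr 1
      ring
  have hfin : ∫⁻ h, ENNReal.ofReal (-φ h) ∂m ≠ ∞ := by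
    refine ne_top_of_le_ne_top (b := (β : ℝ≥0∞)) ENNReal.coe_ne_top ?_
    calc ∫⁻ h, ENNReal.ofReal (-φ h) ∂m ≤ ∫⁻ _, (β : ℝ≥0∞) ∂m := by
          refine lintegral_mono fun h => ?_
          rw [← ENNReal.ofReal_coe_nnreal]
          exact ENNReal.ofReal_le_ofReal (by linarith [hβ h])
      _ = β := by simp
  rw [expect]
  generalize ∫⁻ h, ENNReal.ofReal (φ h + β) ∂m = a at *
  generalize ∫⁻ h, ENNReal.ofReal (-φ h) ∂m = b at *
  generalize ∫⁻ h, ENNReal.ofReal (φ h) ∂m = d at *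
  lift b to ℝ≥0 using hfin
  induction a with
  | top =>
    have : d = ∞ := by simpa using hadd.symm
    subst this
    change (⊤ : EReal) - ((b : ℝ) : EReal) = ⊤ - ((β : ℝ) : EReal)
    rw [EReal.top_sub_coe, EReal.top_sub_coe]
  | coe a =>
    have hd : d ≠ ∞ := fun h => by
      rw [h, top_add] at hadd
      exact ENNReal.coe_ne_top (by exact_mod_cast hadd)
    lift d to ℝ≥0 using hd
    have h2 : (a : ℝ) + b = d + β := by exact_mod_cast hadd
    change ((d : ℝ) : EReal) - ((b : ℝ) : EReal) = ((a : ℝ) : EReal) - ((β : ℝ) : EReal)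
    rw [← EReal.coe_sub, ← EReal.coe_sub]
    congr 1
    linarith

/-- Change of measure; the weight is nonnegative, so it commutes with taking positive and negative
parts. -/
lemma expect_invWeight_mul {X Z Y : Type*} [MeasurableSpace X] [MeasurableSpace Z]
    [MeasurableSpace Y] {S : Set (X × Z × Y)} (P : Measure S) (Q : Kernel (X × Z) Bool)
    {φ : S → ℝ} (hφ : Measurable φ) :
    expect P (fun h => invWeight P Q h * φ h) = expect (weighted P Q) φ := by
  have key : ∀ χ : S → ℝ, Measurable χ →
      ∫⁻ h, ENNReal.ofReal (χ h) ∂weighted P Q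
        = ∫⁻ h, ENNReal.ofReal (invWeight P Q h * χ h) ∂P := fun χ hχ => by
    rw [weighted, lintegral_withDensity_eq_lintegral_mul _ (measurable_invWeight P Q).ennreal_ofReal
      hχ.ennreal_ofReal]
    refine lintegral_congr fun h => ?_
    rw [Pi.mul_apply, ENNReal.ofReal_mul (invWeight_nonneg P Q h)]
  rw [expect, expect, key φ hφ, key (fun h => -φ h) hφ.neg]
  simp only [mul_neg]

/-! ### Weak and strong duality. -/

section Duality

variable {X Z Y : Type*}
  [TopologicalSpace X] [PolishSpace X] [MeasurableSpace X] [BorelSpace X]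
  [TopologicalSpace Z] [PolishSpace Z] [MeasurableSpace Z] [BorelSpace Z]
  [TopologicalSpace Y] [PolishSpace Y] [MeasurableSpace Y] [BorelSpace Y]
  {S : Set (X × Z × Y)}

/-- Weak duality. -/
lemma expect_le_penalized (hS : MeasurableSet S)
    (hinj : Set.InjOn (fun h : X × Z × Y => (h.1, h.2.1)) S)
    {P : Measure S} [IsProbabilityMeasure P] [P.IsOpenPosMeasure]
    {c : S → S → ℝ≥0} (hc : Continuous (Function.uncurry c)) (hc0 : ∀ t, c t t = 0)
    {m₀ : Measure S} (hm₀ : Comparable P m₀) {φ : S → ℝ} (hφ : LowerSemicontinuous φ)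
    {β : ℝ≥0} (hβ : ∀ h, -β ≤ φ h) {ρ : ℝ} (hρ : 0 < ρ) {m : Measure S} [IsProbabilityMeasure m]
    (hW : wasserstein c m m₀ < ENNReal.ofReal ρ) (α : ℝ≥0) :
    expect m φ ≤ (((α : ℝ) * ρ : ℝ) : EReal) +
      ⨆ Q ∈ {Q : Kernel (X × Z) Bool | IsMarkovKernel Q ∧ BoundedAwayFromZero S Q},
        (expect P (fun h => invWeight P Q h * φ h)
          - (((α : ℝ≥0∞) * wasserstein c (weighted P Q) m₀ : ℝ≥0∞) : EReal)) := by
  have hφm := hφ.measurable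
  have hψ : LowerSemicontinuous fun h => φ h + β := hφ.add lowerSemicontinuous_const
  refine EReal.ge_of_forall_gt_iff_ge.1 fun x hx => ?_
  rw [expect_eq_lintegral_sub m hφm hβ] at hx
  have hx' : ((x + β : ℝ) : EReal) < ((∫⁻ h, ENNReal.ofReal (φ h + β) ∂m : ℝ≥0∞) : EReal) := by
    rw [EReal.coe_add]
    exact (EReal.lt_sub_iff_add_lt (Or.inl (EReal.coe_ne_bot _))
      (Or.inl (EReal.coe_ne_top _))).1 hx
  -- When x + β ≤ 0 truncation gives 0, and any measure in the ball, such as `m₀`, already meets the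
  -- target.
  have hr : ENNReal.ofReal (x + β) = 0 ∨
      ENNReal.ofReal (x + β) < ∫⁻ h, ENNReal.ofReal (φ h + β) ∂m := by
    rcases le_total (x + β) 0 with h0 | h0
    · exact Or.inl (ENNReal.ofReal_of_nonpos h0)
    · refine Or.inr (EReal.coe_ennreal_lt_coe_ennreal_iff.1 ?_)
      rwa [EReal.coe_ennreal_ofReal, max_eq_left h0]
  obtain ⟨m', hm', hW', hr'⟩ := hm₀.exists_approx hc hc0 hψ hW hr
  obtain ⟨Q, hQM, hQ, rfl⟩ := hm'.exists_weighted_eq hS hinj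
  have := hm'.prob
  have h1 : (x : EReal) ≤ expect P (fun h => invWeight P Q h * φ h) := by
    rw [expect_invWeight_mul P Q hφm, expect_eq_lintegral_sub _ hφm hβ]
    refine EReal.le_sub_iff_add_le (Or.inl (EReal.coe_ne_bot _))
      (Or.inl (EReal.coe_ne_top _)) |>.2 ?_
    refine le_trans ?_ (EReal.coe_ennreal_le_coe_ennreal_iff.2 hr')
    rw [EReal.coe_ennreal_ofReal, ← EReal.coe_add]
    exact EReal.coe_le_coe_iff.2 (le_max_left _ _)
  have h2 : (((α : ℝ≥0∞) * wasserstein c (weighted P Q) m₀ : ℝ≥0∞) : EReal)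
      ≤ ((α * ρ : ℝ) : EReal) := by
    rw [← max_eq_left (mul_nonneg α.coe_nonneg hρ.le : 0 ≤ (α : ℝ) * ρ), ← EReal.coe_ennreal_ofReal,
      ENNReal.ofReal_mul α.coe_nonneg, EReal.coe_ennreal_le_coe_ennreal_iff]
    rw [ENNReal.ofReal_coe_nnreal]
    gcongr
  calc (x : EReal) = ((α * ρ : ℝ) : EReal) + ((x : EReal) - ((α * ρ : ℝ) : EReal)) := by
        rw [← EReal.coe_sub, ← EReal.coe_add, add_sub_cancel]
    _ ≤ _ := by
        gcongr
        exact (EReal.sub_le_sub h1 h2).trans (le_iSup₂_of_le Q ⟨hQM, hQ⟩ le_rfl)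

/-- Strong duality. -/
lemma iInf_penalized_le {P : Measure S} [IsProbabilityMeasure P]
    {c : S → S → ℝ≥0} (hc : Continuous (Function.uncurry c)) (hc0 : ∀ t, c t t = 0)
    {m₀ : Measure S} (hm₀ : Comparable P m₀) {φ : S → ℝ} (hφm : Measurable φ)
    {β : ℝ≥0} (hβ : ∀ h, -β ≤ φ h) {ρ : ℝ} (hρ : 0 < ρ) {v : ℝ}
    (hv : ∀ m, IsProbabilityMeasure m → wasserstein c m m₀ < ENNReal.ofReal ρ →
      expect m φ ≤ v) :
    (⨅ α : ℝ≥0, (((α : ℝ) * ρ : ℝ) : EReal) +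
      ⨆ Q ∈ {Q : Kernel (X × Z) Bool | IsMarkovKernel Q ∧ BoundedAwayFromZero S Q},
        (expect P (fun h => invWeight P Q h * φ h)
          - (((α : ℝ≥0∞) * wasserstein c (weighted P Q) m₀ : ℝ≥0∞) : EReal))) ≤ v := by
  have hv' : ∀ m, IsProbabilityMeasure m → wasserstein c m m₀ < ENNReal.ofReal ρ →
      ((∫⁻ h, ENNReal.ofReal (φ h + β) ∂m : ℝ≥0∞) : EReal) ≤ ((v + β : ℝ) : EReal) := by
    intro m hm hW
    have h1 := hv m hm hW
    rw [expect_eq_lintegral_sub m hφm hβ] at h1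
    rw [EReal.coe_add]
    exact (EReal.sub_le_iff_le_add (Or.inl (EReal.coe_ne_bot _))
      (Or.inl (EReal.coe_ne_top _))).1 h1
  have hfin : ∀ {a : ℝ≥0∞} {x : ℝ}, (a : EReal) ≤ x → a < ∞ := fun {a x} h => by
    refine lt_top_iff_ne_top.2 fun ha => ?_
    rw [ha, EReal.coe_ennreal_top] at h
    exact EReal.coe_ne_top x (top_le_iff.1 h)
  -- The centre `m₀` lies in the ball, so its expectation is bounded by `v`.
  have hg : ∫⁻ h, ENNReal.ofReal (φ h + β) ∂m₀ < ∞ := hfin (hv' m₀ hm₀.prob (by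
    rw [wasserstein_self c hc.measurable hc0]
    exact ENNReal.ofReal_pos.2 hρ))
  obtain ⟨α, hα, h⟩ := hm₀.exists_multiplier hc.measurable hc0 hg hρ (v := v + β) (by
    intro m hm hW
    have h1 := hv' m hm.prob hW
    rw [← ENNReal.ofReal_toReal (hm₀.lintegral_lt_top hm hg).ne, EReal.coe_ennreal_ofReal,
      max_eq_left ENNReal.toReal_nonneg] at h1
    exact EReal.coe_le_coe_iff.1 h1)
  refine EReal.le_of_forall_lt_iff_le.1 fun z hz => ?_
  have hz : 0 < (z - v) / ρ := div_pos (sub_pos.2 (EReal.coe_lt_coe_iff.1 hz)) hρ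
  -- The slack z − v = ερ raises the multiplier to α + ε > 0. If α were 0, the convention 0·∞ = 0
  -- would cancel the penalty at infinite discrepancy.
  set ε := (z - v) / ρ with hε
  have hερ : ε * ρ = z - v := div_mul_cancel₀ _ hρ.ne'
  refine iInf_le_of_le ⟨α + ε, by positivity⟩ ?_
  change (((α + ε) * ρ : ℝ) : EReal) + _ ≤ _
  calc _ ≤ (((α + ε) * ρ : ℝ) : EReal) + ((z - (α + ε) * ρ : ℝ) : EReal) := by
        gcongr
        refine iSup₂_le fun Q hQ => ?_
        obtain ⟨hQM, hQ⟩ := hQ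
        have hm := weighted_comparable P Q hQ
        have := hm.prob
        have hb := h _ hm
        rw [expect_invWeight_mul P Q hφm, expect_eq_lintegral_sub _ hφm hβ]
        have hF := (hm₀.lintegral_lt_top hm hg).ne
        generalize ∫⁻ h, ENNReal.ofReal (φ h + β) ∂weighted P Q = F at *
        generalize wasserstein c (weighted P Q) m₀ = w at *
        lift F to ℝ≥0 using hF
        induction w with
        | top =>
          rw [ENNReal.mul_top (by
            refine ENNReal.coe_ne_zero.2 fun h0 => ?_
            have := congrArg NNReal.toReal h0
            change α + ε = 0 at this
            linarith), EReal.coe_ennreal_top, EReal.sub_top]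
          exact bot_le
        | coe w =>
          have h1 := hb ENNReal.coe_ne_top
          rw [ENNReal.coe_toReal, ENNReal.coe_toReal] at h1
          change ((F : ℝ) : EReal) - ((β : ℝ) : EReal) - (((α + ε) * w : ℝ) : EReal) ≤ _
          rw [← EReal.coe_sub, ← EReal.coe_sub, EReal.coe_le_coe_iff]
          have h2 : 0 ≤ ε * w := by positivity
          linarith
    _ = z := by rw [← EReal.coe_add, add_sub_cancel]

end Duality

end ExposureDual

open ExposureDual in
theorem claim2
    {X Z Y : Type*}
    [TopologicalSpace X] [PolishSpace X] [MeasurableSpace X] [BorelSpace X]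
    [TopologicalSpace Z] [PolishSpace Z] [MeasurableSpace Z] [BorelSpace Z]
    [TopologicalSpace Y] [PolishSpace Y] [MeasurableSpace Y] [BorelSpace Y]
    -- the sample space of records `(x, z, y)`; every feature pair carries one feedback
    (S : Set (X × Z × Y)) (hS : MeasurableSet S)
    (hinj : Set.InjOn (fun h : X × Z × Y => (h.1, h.2.1)) S)
    -- the data distribution, which charges the whole sample space
    (P : Measure S) [IsProbabilityMeasure P] [P.IsOpenPosMeasure]
    -- the transportation cost
    (c : S → S → ℝ≥0) (hc : Continuous (Function.uncurry c)) (hc0 : ∀ t, c t t = 0)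
    -- the underlying exposure mechanism
    (Q₀ : Kernel (X × Z) Bool) [IsMarkovKernel Q₀]
    (μ : ℝ) (hμ : 0 < μ) (hQ₀ : ∀ h : S, μ ≤ ExposureDual.propensity Q₀ h)
    -- the candidate model and its loss
    (f : X → Z → ℝ) (δ : Y → ℝ → ℝ)
    (hδ : LowerSemicontinuous fun h : S => δ h.1.2.2 (f h.1.1 h.1.2.1))
    (hδb : BddBelow (Set.range fun h : S => δ h.1.2.2 (f h.1.1 h.1.2.1)))
    (ρ : ℝ) (hρ : 0 < ρ) :
    (⨆ P' ∈ {P' : Measure S | IsProbabilityMeasure P' ∧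
          ExposureDual.wasserstein c P' (ExposureDual.weighted P Q₀) < ENNReal.ofReal ρ},
        ExposureDual.expect P' fun h => δ h.1.2.2 (f h.1.1 h.1.2.1))
      = ⨅ α : ℝ≥0, (((α : ℝ) * ρ : ℝ) : EReal) +
          ⨆ Q ∈ {Q : Kernel (X × Z) Bool |
              IsMarkovKernel Q ∧ ExposureDual.BoundedAwayFromZero S Q},
            (ExposureDual.expect P
                (fun h => ExposureDual.invWeight P Q h * δ h.1.2.2 (f h.1.1 h.1.2.1))
              - (((α : ℝ≥0∞) * ExposureDual.wasserstein c (ExposureDual.weighted P Q)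
                    (ExposureDual.weighted P Q₀) : ℝ≥0∞) : EReal)) := by
  have hm₀ : Comparable P (weighted P Q₀) := weighted_comparable P Q₀ ⟨μ, hμ, hQ₀⟩
  have := hm₀.prob
  obtain ⟨β, hβ⟩ : ∃ β : ℝ≥0, ∀ h : S, -β ≤ δ h.1.2.2 (f h.1.1 h.1.2.1) := by
    obtain ⟨b, hb⟩ := hδb
    refine ⟨(-b).toNNReal, fun h => ?_⟩
    have h1 := hb ⟨h, rfl⟩
    have h2 := Real.le_coe_toNNReal (-b)
    simp only at h1
    linarith
  have hφm := hδ.measurable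
  refine le_antisymm (iSup₂_le fun m hm => le_iInf fun α => ?_) ?_
  · have := hm.1
    exact expect_le_penalized hS hinj hc hc0 hm₀ hδ hβ hρ hm.2 α
  -- Testing against real `v` above the supremum makes the case of an infinite supremum vacuous.
  · refine EReal.le_of_forall_lt_iff_le.1 fun v hv => ?_
    exact iInf_penalized_le hc hc0 hm₀ hφm hβ hρ fun m hm hW =>
      (le_iSup₂_of_le m ⟨hm, hW⟩ le_rfl).trans hv.le
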